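/- For $n\ge 1$ let $B_n$ be the set of all Boolean functions $f:\mathbb F_2^n\to\mathbb F_2$. For $f\in B_n$ and $u\in\mathbb F_2^n$ put \[ \Delta_f(u)=\sum_{x\in\mathbb F_2^n}(-1)^{f(x)+f(x+u)}, \] and define the absolute indicator of $f$ by \[ \Delta(f)=\max_{u\in\mathbb F_2^n\setminus\{0\}}|\Delta_f(u)| . \] Let $f_n$ be drawn uniformly at random from $B_n$. Then \[ \frac{\mathbb E[\Delta(f_n)]}{\sqrt{2^n\log 2^n}}\longrightarrow 2\qquad\text{as } n\to\infty , \] where $\log$ is the natural logarithm. Moreover, for every $\epsilon>0$, \[ \mathbb P\left[\left|\frac{\Delta(f_n)}{2\sqrt{2^n\log 2^n}}-1\right|>\epsilon\right]\longrightarrow 0\qquad\text{as } n\to\infty . \] -/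

import Mathlib

open MeasureTheory ProbabilityTheory Filter Topology

/-- The vector space `𝔽₂ⁿ`. -/
abbrev F2 (n : ℕ) : Type := Fin n → ZMod 2

/-- The set `Bₙ` of Boolean functions of `n` variables. Its measurable structure is the product one,
for which (the type being finite) every subset is measurable. -/
abbrev BoolFun (n : ℕ) : Type := F2 n → ZMod 2

/-- The autocorrelation `Δ_f(u) = ∑ₓ (-1)^(f(x) + f(x + u))`. -/
def autocorr {n : ℕ} (f : BoolFun n) (u : F2 n) : ℤ :=
  ∑ x : F2 n, (-1 : ℤ) ^ (f x + f (x + u)).val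

/-- The absolute indicator `Δ(f) = max_{u ≠ 0} |Δ_f(u)|`. For `n ≥ 1` the index set is nonempty and
this is a maximum; for `n = 0` the value is `0`. -/
def absIndicator {n : ℕ} (f : BoolFun n) : ℕ :=
  (Finset.univ.filter fun u : F2 n => u ≠ 0).sup fun u => (autocorr f u).natAbs

/-- The uniform probability measure on the set of all Boolean functions of `n` variables. -/
noncomputable def unifBool (n : ℕ) : Measure (BoolFun n) :=
  uniformOn (Set.univ : Set (BoolFun n))

/-! Write `N = 2 ^ n` and `L = log N`. For `u ≠ 0` the autocorrelation is twice a sum of `N / 2`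
independent signs, one per coset of the line spanned by `u`, so it behaves like a centred Gaussian
of variance `2N`. The maximum of about `N` such variables should be `2 √(N L)`.

Upper bound: the exponential moment `sum_exp_autocorr`, a union bound over `u` and Jensen bound the
mean (`exp_meanIndicator_le`). Lower bound: a binomial estimate (`le_card_le_autocorr`) gives each
event `2a √(N L) ≤ autocorr f u` probability at least `N ^ (-b)` for any `b > a ^ 2`, eventually. A
joint exponential moment over cosets of the plane spanned by `u` and `v` (`sum_exp_autocorr_add`)
bounds pair probabilities by `2 N ^ (-2a ^ 2)`. For `a < 1` the second moment method then yields
only probability `N ^ (-δ) / 4` for a large maximum, with `δ` arbitrarily small. That suffices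
because of concentration: altering one value of `f` moves the indicator by at most `4`, so deviating
from the mean by `ε √(N L)` has probability at most `N ^ (-ε ^ 2 / 8)` on each side. With `δ < ε ^ 2
/ 8` the mean cannot lie far below `2a √(N L)`. The same concentration turns the limit of the mean
into convergence in probability. -/

/-! ### Coset decompositions and averages of products -/

/-- The coset decomposition along an injective homomorphism, with a section chosen. -/
theorem exists_coset_equiv {G K : Type} [AddCommGroup G] [Fintype G] [AddCommGroup K]
    (i : K →+ G) (hi : Function.Injective i) :
    ∃ (Q : Type) (_ : Fintype Q) (e : Q × K ≃ G), ∀ q k l, e (q, k) + i l = e (q, k + l) := by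
  classical
  refine ⟨G ⧸ i.range, Fintype.ofFinite _,
    Equiv.ofBijective (fun p => p.1.out + i p.2) ⟨?_, ?_⟩, ?_⟩
  · rintro ⟨q, k⟩ ⟨r, l⟩ h
    replace h : q.out + i k = r.out + i l := h
    have hq : q = r := by
      rw [← QuotientAddGroup.out_eq' q, ← QuotientAddGroup.out_eq' r, QuotientAddGroup.eq]
      exact AddMonoidHom.mem_range.2 ⟨k - l, by
        rw [map_sub, eq_neg_add_iff_add_eq, ← add_sub_assoc, h, add_sub_cancel_right]⟩
    subst hq
    rw [hi (add_left_cancel h)]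
  · intro g
    obtain ⟨k, hk⟩ : -((g : G ⧸ i.range).out) + g ∈ i.range := by
      rw [← QuotientAddGroup.eq, QuotientAddGroup.out_eq']
    exact ⟨(g, k), by simp [hk]⟩
  · intro q k l
    change q.out + i k + i l = q.out + i (k + l)
    rw [map_add, add_assoc]

/-- A product over the cosets averages to a power. -/
theorem sum_prod_fiber {G K Q : Type} [Fintype G] [DecidableEq G] [Fintype K] [DecidableEq K]
    [Fintype Q] (e : Q × K ≃ G) (Φ : (K → ZMod 2) → ℝ) :
    ∑ f : G → ZMod 2, ∏ q, Φ (fun k => f (e (q, k))) = (∑ g, Φ g) ^ Fintype.card Q := by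
  classical
  rw [← Finset.card_univ, ← Finset.prod_const, Finset.prod_univ_sum, Fintype.piFinset_univ]
  exact Fintype.sum_equiv ((e.symm.arrowCongr (Equiv.refl _)).trans (Equiv.curry Q K (ZMod 2)))
    _ _ fun f => rfl

/-! ### Autocorrelations as sums over cosets of lines and planes -/

/-- The nontrivial sign character of `ZMod 2`. -/
def sgn (a : ZMod 2) : ℤ := (-1) ^ a.val

theorem sgn_add (a b : ZMod 2) : sgn (a + b) = sgn a * sgn b := by
  revert a b; decide

theorem autocorr_eq {n : ℕ} (f : BoolFun n) (u : F2 n) :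
    autocorr f u = ∑ x, sgn (f x) * sgn (f (x + u)) := by
  simp only [← sgn_add]; rfl

theorem sum_zmodTwo_arrow {α : Type} [Fintype α] (F : (ZMod 2 → α) → ℝ) :
    ∑ g, F g = ∑ a, ∑ b, F fun i => if i = 0 then a else b := by
  rw [← Fintype.sum_prod_type' fun a b => F fun i => if i = 0 then a else b]
  refine Fintype.sum_equiv ⟨fun g => (g 0, g 1), fun p i => if i = 0 then p.1 else p.2,
    fun g => ?_, fun p => ?_⟩ _ _ fun g => ?_
  · funext i; fin_cases i <;> rfl
  · rfl
  · refine congrArg F ?_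
    funext i; fin_cases i <;> rfl

theorem exists_line_equiv {n : ℕ} {u : F2 n} (hu : u ≠ 0) :
    ∃ (Q : Type) (_ : Fintype Q) (e : Q × ZMod 2 ≃ F2 n),
      ∀ q k, e (q, k) + u = e (q, k + 1) := by
  obtain ⟨Q, hQ, e, he⟩ := exists_coset_equiv
    (LinearMap.toSpanSingleton (ZMod 2) (F2 n) u).toAddMonoidHom
    (fun a b h => by
      simp only [LinearMap.toAddMonoidHom_coe, LinearMap.toSpanSingleton_apply] at h
      exact smul_left_injective _ hu h)
  refine ⟨Q, hQ, e, fun q k => ?_⟩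
  rw [← he]; simp

theorem exists_plane_equiv {n : ℕ} {u v : F2 n} (hu : u ≠ 0) (hv : v ≠ 0) (huv : u ≠ v) :
    ∃ (Q : Type) (_ : Fintype Q) (e : Q × (ZMod 2 × ZMod 2) ≃ F2 n),
      (∀ q k, e (q, k) + u = e (q, k + (1, 0))) ∧ ∀ q k, e (q, k) + v = e (q, k + (0, 1)) := by
  obtain ⟨Q, hQ, e, he⟩ := exists_coset_equiv
    ((LinearMap.toSpanSingleton (ZMod 2) (F2 n) u).coprod
      (LinearMap.toSpanSingleton (ZMod 2) (F2 n) v)).toAddMonoidHom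
    ((injective_iff_map_eq_zero _).2 (by
      have h2 : u + v ≠ 0 := fun h => huv (by
        rw [add_eq_zero_iff_eq_neg] at h
        rw [h]; ext i; exact ZMod.neg_eq_self_mod_two _)
      rintro ⟨a, b⟩ h
      simp only [LinearMap.toAddMonoidHom_coe, LinearMap.coprod_apply,
        LinearMap.toSpanSingleton_apply] at h
      fin_cases a <;> fin_cases b
      · rfl
      · replace h : (0 : ZMod 2) • u + (1 : ZMod 2) • v = 0 := h
        exact absurd (by simpa using h) hv
      · replace h : (1 : ZMod 2) • u + (0 : ZMod 2) • v = 0 := h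
        exact absurd (by simpa using h) hu
      · replace h : (1 : ZMod 2) • u + (1 : ZMod 2) • v = 0 := h
        exact absurd (by simpa using h) h2))
  refine ⟨Q, hQ, e, fun q k => ?_, fun q k => ?_⟩ <;> rw [← he] <;> simp

theorem card_line {n : ℕ} {Q : Type} [Fintype Q] (e : Q × ZMod 2 ≃ F2 n) :
    Fintype.card Q * 2 = 2 ^ n := by
  have := Fintype.card_congr e
  simpa [Fintype.card_prod, ZMod.card] using this

theorem card_plane {n : ℕ} {Q : Type} [Fintype Q] (e : Q × (ZMod 2 × ZMod 2) ≃ F2 n) :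
    Fintype.card Q * 4 = 2 ^ n := by
  have := Fintype.card_congr e
  simpa [Fintype.card_prod, ZMod.card] using this

theorem card_boolFun (n : ℕ) : Fintype.card (BoolFun n) = 2 ^ 2 ^ n := by
  simp [ZMod.card]

theorem autocorr_line {n : ℕ} {u : F2 n} {Q : Type} [Fintype Q] (e : Q × ZMod 2 ≃ F2 n)
    (he : ∀ q k, e (q, k) + u = e (q, k + 1)) (f : BoolFun n) :
    autocorr f u = ∑ q, 2 * sgn (f (e (q, 0))) * sgn (f (e (q, 1))) := by
  rw [autocorr_eq, ← e.sum_comp, Fintype.sum_prod_type]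
  refine Finset.sum_congr rfl fun q _ => ?_
  rw [show (Finset.univ : Finset (ZMod 2)) = {0, 1} from rfl, Finset.sum_pair (by decide), he, he,
    show (1 : ZMod 2) + 1 = 0 from rfl, zero_add]
  ring

theorem autocorr_add_plane {n : ℕ} {u v : F2 n} {Q : Type} [Fintype Q]
    (e : Q × (ZMod 2 × ZMod 2) ≃ F2 n)
    (hu : ∀ q k, e (q, k) + u = e (q, k + (1, 0))) (hv : ∀ q k, e (q, k) + v = e (q, k + (0, 1)))
    (f : BoolFun n) :
    autocorr f u + autocorr f v = ∑ q, 2 * (sgn (f (e (q, (0, 0)))) + sgn (f (e (q, (1, 1))))) *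
      (sgn (f (e (q, (1, 0)))) + sgn (f (e (q, (0, 1))))) := by
  rw [autocorr_eq, autocorr_eq, ← e.sum_comp, ← e.sum_comp (fun x => sgn (f x) * sgn (f (x + v))),
    Fintype.sum_prod_type, Fintype.sum_prod_type, ← Finset.sum_add_distrib]
  refine Finset.sum_congr rfl fun q _ => ?_
  simp only [hu, hv, Fintype.sum_prod_type]
  simp only [show (Finset.univ : Finset (ZMod 2)) = {0, 1} from rfl,
    Finset.sum_pair (show (0 : ZMod 2) ≠ 1 by decide), Prod.mk_add_mk, zero_add, add_zero,
    show (1 : ZMod 2) + 1 = 0 from rfl]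
  ring

/-! ### Exponential moments of one and of two autocorrelations -/

theorem sum_exp_autocorr {n : ℕ} {u : F2 n} (hu : u ≠ 0) (t : ℝ) :
    ∑ f : BoolFun n, Real.exp (t * autocorr f u) ≤ 2 ^ 2 ^ n * Real.exp (t ^ 2 * 2 ^ n) := by
  obtain ⟨Q, _, e, he⟩ := exists_line_equiv hu
  have hQ := card_line e
  have h := sum_prod_fiber e fun g => Real.exp (t * (2 * sgn (g 0) * sgn (g 1) : ℤ))
  have hs : ∑ g : ZMod 2 → ZMod 2, Real.exp (t * (2 * sgn (g 0) * sgn (g 1) : ℤ)) =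
      4 * Real.cosh (2 * t) := by
    rw [sum_zmodTwo_arrow]
    simp only [show (Finset.univ : Finset (ZMod 2)) = {0, 1} from rfl,
      Finset.sum_pair (show (0 : ZMod 2) ≠ 1 by decide)]
    have h0 : sgn 0 = 1 := rfl
    have h1 : sgn 1 = -1 := rfl
    simp [h0, h1, Real.cosh_eq]
    ring_nf
  rw [hs] at h
  simp only [autocorr_line e he, Int.cast_sum, Finset.mul_sum, Real.exp_sum]
  rw [h]
  calc (4 * Real.cosh (2 * t)) ^ Fintype.card Q
      ≤ (4 * Real.exp ((2 * t) ^ 2 / 2)) ^ Fintype.card Q := by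
        gcongr
        exact Real.cosh_le_exp_half_sq _
    _ = _ := by
        rw [mul_pow, ← Real.exp_nat_mul, ← hQ, mul_comm (Fintype.card Q) 2, pow_mul]
        congr 2
        · norm_num
        · have : (2 : ℝ) ^ n = Fintype.card Q * 2 := by exact_mod_cast hQ.symm
          rw [this]; ring

/-- The leading exponent `2 * t ^ 2 * 2 ^ n` is what two independent autocorrelations would give;
the dependence costs only the quartic term, negligible at the `t` used later. -/
theorem sum_exp_autocorr_add {n : ℕ} {u v : F2 n} (hu : u ≠ 0) (hv : v ≠ 0) (huv : u ≠ v) {t : ℝ}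
    (ht : 32 * t ^ 2 ≤ 1) :
    ∑ f : BoolFun n, Real.exp (t * (autocorr f u + autocorr f v)) ≤
      2 ^ 2 ^ n * Real.exp (2 * t ^ 2 * 2 ^ n + 64 * t ^ 4 * 2 ^ n) := by
  obtain ⟨Q, _, e, he1, he2⟩ := exists_plane_equiv hu hv huv
  have hQ := card_plane e
  have h := sum_prod_fiber e fun g => Real.exp (t * (2 * (sgn (g (0, 0)) + sgn (g (1, 1))) *
      (sgn (g (1, 0)) + sgn (g (0, 1))) : ℤ))
  -- On one plane coset the summand is `8` or `-8` with probability `1/8` each, and `0` otherwise.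
  have hs : ∑ g : ZMod 2 × ZMod 2 → ZMod 2,
      Real.exp (t * (2 * (sgn (g (0, 0)) + sgn (g (1, 1))) *
      (sgn (g (1, 0)) + sgn (g (0, 1))) : ℤ)) =
      16 * (3 / 4 + Real.cosh (8 * t) / 4) := by
    rw [← (Equiv.curry (ZMod 2) (ZMod 2) (ZMod 2)).symm.sum_comp,
      sum_zmodTwo_arrow]
    simp only [sum_zmodTwo_arrow]
    simp only [show (Finset.univ : Finset (ZMod 2)) = {0, 1} from rfl,
      Finset.sum_pair (show (0 : ZMod 2) ≠ 1 by decide)]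
    have h0 : sgn 0 = 1 := rfl
    have h1 : sgn 1 = -1 := rfl
    simp [Function.uncurry, h0, h1, Real.cosh_eq]
    ring_nf
  rw [hs] at h
  simp only [← Int.cast_add, autocorr_add_plane e he1 he2, Int.cast_sum, Finset.mul_sum,
    Real.exp_sum]
  rw [h]
  -- Expanding `exp` to second order at `32 * t ^ 2` keeps the factor `1/4` on the quadratic term.
  have hc : 3 / 4 + Real.cosh (8 * t) / 4 ≤ Real.exp (8 * t ^ 2 + 256 * t ^ 4) := by
    have h1 := Real.cosh_le_exp_half_sq (8 * t)
    have h2 : Real.exp ((8 * t) ^ 2 / 2) ≤ 1 + 32 * t ^ 2 + (32 * t ^ 2) ^ 2 := by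
      have h3 := Real.abs_exp_sub_one_sub_id_le (x := 32 * t ^ 2)
        (by rw [abs_of_nonneg (by positivity)]; exact ht)
      rw [show (8 * t) ^ 2 / 2 = 32 * t ^ 2 by ring]
      linarith [(abs_le.1 h3).2]
    have h4 := Real.add_one_le_exp (8 * t ^ 2 + 256 * t ^ 4)
    nlinarith
  calc (16 * (3 / 4 + Real.cosh (8 * t) / 4)) ^ Fintype.card Q
      ≤ (16 * Real.exp (8 * t ^ 2 + 256 * t ^ 4)) ^ Fintype.card Q := by
        gcongr
    _ = _ := by
        rw [mul_pow, ← Real.exp_nat_mul, ← hQ, mul_comm (Fintype.card Q) 4, pow_mul]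
        congr 2
        · norm_num
        · have : (2 : ℝ) ^ n = Fintype.card Q * 4 := by exact_mod_cast hQ.symm
          rw [this]; ring

/-! ### Bounded differences and concentration of the absolute indicator -/

/-- Hoeffding's lemma for a fair two-point distribution, from `cosh x ≤ exp (x ^ 2 / 2)`; it is the
single-coordinate step of the bounded differences inequality. -/
theorem exp_add_exp_le {a b c : ℝ} (h : |a - b| ≤ c) :
    Real.exp a + Real.exp b ≤ 2 * Real.exp ((a + b) / 2 + c ^ 2 / 8) := by
  have h1 : Real.exp a + Real.exp b = 2 * (Real.exp ((a + b) / 2) * Real.cosh ((a - b) / 2)) := by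
    rw [Real.cosh_eq, mul_div_assoc', mul_add, ← Real.exp_add, ← Real.exp_add]
    ring_nf
  rw [h1, Real.exp_add]
  gcongr
  refine (Real.cosh_le_exp_half_sq _).trans (Real.exp_le_exp.2 ?_)
  have := sq_le_sq' (abs_le.1 h).1 (abs_le.1 h).2
  nlinarith

/-- The exponential form of the bounded differences inequality on `Fin d → ZMod 2`. -/
theorem sum_exp_le_of_bounded_diff_fin (d : ℕ) : ∀ (F : (Fin d → ZMod 2) → ℝ) (c : ℝ),
    (∀ i f g, (∀ j, j ≠ i → f j = g j) → |F f - F g| ≤ c) →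
    ∑ f, Real.exp (F f) ≤ 2 ^ d * Real.exp ((∑ f, F f) / 2 ^ d + d * (c ^ 2 / 8)) := by
  induction d with
  | zero => intro F c _; simp
  | succ d ih =>
    intro F c hF
    have key : ∀ H : (Fin (d + 1) → ZMod 2) → ℝ,
        ∑ f, H f = ∑ g : Fin d → ZMod 2, (H (Fin.cons 0 g) + H (Fin.cons 1 g)) := by
      intro H
      rw [← (Fin.consEquiv fun _ => ZMod 2).sum_comp, Fintype.sum_prod_type_right]
      refine Finset.sum_congr rfl fun g _ => ?_
      rw [show (Finset.univ : Finset (ZMod 2)) = {0, 1} from rfl, Finset.sum_pair (by decide)]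
      rfl
    -- Averaging out the first coordinate preserves both the mean and the bound `c` on differences.
    have h := ih (fun g => (F (Fin.cons 0 g) + F (Fin.cons 1 g)) / 2) c (by
      intro i f g hfg
      have h (a : ZMod 2) : |F (Fin.cons a f) - F (Fin.cons a g)| ≤ c :=
        hF i.succ _ _ fun j => by
          refine Fin.cases (fun _ => by simp) (fun k hk => ?_) j
          simpa using hfg k fun h => hk (by rw [h])
      have h0 := abs_le.1 (h 0)
      have h1 := abs_le.1 (h 1)
      rw [abs_le]
      constructor <;> linarith)
    rw [key, key]
    calc ∑ g : Fin d → ZMod 2, (Real.exp (F (Fin.cons 0 g)) + Real.exp (F (Fin.cons 1 g)))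
        ≤ ∑ g : Fin d → ZMod 2, 2 * Real.exp (c ^ 2 / 8) *
            Real.exp ((F (Fin.cons 0 g) + F (Fin.cons 1 g)) / 2) := by
          refine Finset.sum_le_sum fun g _ => ?_
          refine (exp_add_exp_le (hF 0 _ _ fun j => ?_)).trans_eq ?_
          · refine Fin.cases (fun h => absurd rfl h) (fun k _ => by simp) j
          · rw [Real.exp_add]; ring
      _ ≤ 2 * Real.exp (c ^ 2 / 8) * (2 ^ d * Real.exp
            ((∑ g : Fin d → ZMod 2, (F (Fin.cons 0 g) + F (Fin.cons 1 g)) / 2) / 2 ^ d +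
              d * (c ^ 2 / 8))) := by
          rw [← Finset.mul_sum]; gcongr
      _ = _ := by
          have h3 : (∑ g : Fin d → ZMod 2, (F (Fin.cons 0 g) + F (Fin.cons 1 g))) / 2 ^ (d + 1) +
              ((d + 1 : ℕ) : ℝ) * (c ^ 2 / 8) = c ^ 2 / 8 +
              ((∑ g : Fin d → ZMod 2, (F (Fin.cons 0 g) + F (Fin.cons 1 g)) / 2) / 2 ^ d +
              d * (c ^ 2 / 8)) := by
            rw [← Finset.sum_div]; push_cast; field_simp; ring
          rw [h3, Real.exp_add (c ^ 2 / 8)]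
          ring

theorem sum_exp_le_of_bounded_diff {ι : Type} [Fintype ι] [DecidableEq ι]
    (F : (ι → ZMod 2) → ℝ) (c : ℝ)
    (hF : ∀ i f g, (∀ j, j ≠ i → f j = g j) → |F f - F g| ≤ c) :
    ∑ f, Real.exp (F f) ≤ 2 ^ Fintype.card ι *
      Real.exp ((∑ f, F f) / 2 ^ Fintype.card ι + Fintype.card ι * (c ^ 2 / 8)) := by
  let e := Fintype.equivFin ι
  let E : (Fin (Fintype.card ι) → ZMod 2) ≃ (ι → ZMod 2) := e.symm.arrowCongr (Equiv.refl _)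
  rw [← E.sum_comp, ← E.sum_comp]
  refine sum_exp_le_of_bounded_diff_fin _ (fun f => F (E f)) c fun i f g h => ?_
  exact hF (e.symm i) _ _ fun j hj => h _ fun h' => hj (by simp [← h'])

/-- Only the terms `x = i` and `x = i - u` see the value at `i`, and each changes by at most `2`. -/
theorem abs_autocorr_sub_le {n : ℕ} (u : F2 n) (i : F2 n) (f g : BoolFun n)
    (h : ∀ j, j ≠ i → f j = g j) : |autocorr f u - autocorr g u| ≤ 4 := by
  have hs : ∀ a b c d : ZMod 2, |sgn a * sgn b - sgn c * sgn d| ≤ 2 := by decide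
  rw [autocorr_eq, autocorr_eq, ← Finset.sum_sub_distrib]
  rw [← Finset.sum_subset (Finset.subset_univ ({i, i - u} : Finset (F2 n)))]
  · refine (Finset.abs_sum_le_sum_abs _ _).trans ((Finset.sum_le_card_nsmul _ _ 2
      fun x _ => hs _ _ _ _).trans ?_)
    have := Finset.card_le_two (a := i) (b := i - u)
    rw [nsmul_eq_mul]
    have : ((Finset.card {i, i - u} : ℕ) : ℤ) ≤ 2 := by exact_mod_cast this
    linarith
  · intro x _ hx
    simp only [Finset.mem_insert, Finset.mem_singleton, not_or] at hx
    rw [h x hx.1, h (x + u) fun h' => hx.2 (by rw [← h', add_sub_cancel_right]), sub_self]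

theorem absIndicator_le_add {n : ℕ} (i : F2 n) (f g : BoolFun n)
    (h : ∀ j, j ≠ i → f j = g j) : absIndicator f ≤ absIndicator g + 4 := by
  refine Finset.sup_le fun u hu => ?_
  have h1 := abs_autocorr_sub_le u i f g h
  rw [abs_le] at h1
  have h2 : (autocorr g u).natAbs ≤ absIndicator g :=
    Finset.le_sup (f := fun u => (autocorr g u).natAbs) hu
  omega

theorem abs_absIndicator_sub_le {n : ℕ} (i : F2 n) (f g : BoolFun n)
    (h : ∀ j, j ≠ i → f j = g j) : |(absIndicator f : ℝ) - absIndicator g| ≤ 4 := by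
  have h1 : (absIndicator f : ℝ) ≤ absIndicator g + 4 := by
    exact_mod_cast absIndicator_le_add i f g h
  have h2 : (absIndicator g : ℝ) ≤ absIndicator f + 4 := by
    exact_mod_cast absIndicator_le_add i g f fun j hj => (h j hj).symm
  rw [abs_le]; constructor <;> linarith

/-- The expected absolute indicator. -/
noncomputable def meanIndicator (n : ℕ) : ℝ :=
  (∑ f : BoolFun n, (absIndicator f : ℝ)) / 2 ^ 2 ^ n

theorem sum_exp_absIndicator_le (n : ℕ) (t : ℝ) :
    ∑ f : BoolFun n, Real.exp (t * absIndicator f) ≤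
      2 ^ 2 ^ n * Real.exp (t * meanIndicator n + 2 ^ n * (2 * t ^ 2)) := by
  have h := sum_exp_le_of_bounded_diff (fun f : BoolFun n => t * absIndicator f) (|t| * 4)
    fun i f g hfg => by
      rw [← mul_sub, abs_mul]
      exact mul_le_mul_of_nonneg_left (abs_absIndicator_sub_le i f g hfg) (abs_nonneg _)
  have hc : Fintype.card (F2 n) = 2 ^ n := by simp [ZMod.card]
  rw [hc, ← Finset.mul_sum, mul_div_assoc, mul_pow, sq_abs] at h
  refine h.trans_eq ?_
  rw [meanIndicator]
  push_cast
  ring_nf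

theorem card_mul_exp_le_sum {α : Type} [Fintype α] (p : α → Prop) [DecidablePred p] (X : α → ℝ)
    (a : ℝ) (h : ∀ x, p x → a ≤ X x) :
    ((Finset.univ.filter p).card : ℝ) * Real.exp a ≤ ∑ x, Real.exp (X x) := by
  rw [← nsmul_eq_mul]
  refine (Finset.card_nsmul_le_sum _ (fun x => Real.exp (X x)) _ fun x hx =>
    Real.exp_le_exp.2 (h x (Finset.mem_filter.1 hx).2)).trans ?_
  exact Finset.sum_le_sum_of_subset_of_nonneg (Finset.subset_univ _) fun _ _ _ => (Real.exp_pos _).le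

/-- The upper tail of the absolute indicator. -/
theorem card_add_le_absIndicator (n : ℕ) {s : ℝ} (hs : 0 ≤ s) :
    ((Finset.univ.filter fun f : BoolFun n => meanIndicator n + s ≤ absIndicator f).card : ℝ) ≤
      2 ^ 2 ^ n * Real.exp (-(s ^ 2 / (8 * 2 ^ n))) := by
  have hN : (0 : ℝ) < 2 ^ n := by positivity
  -- This `t` minimizes the Chernoff exponent `2 * 2 ^ n * t ^ 2 - t * s`.
  set t := s / (4 * 2 ^ n) with ht
  have h := (card_mul_exp_le_sum (fun f : BoolFun n => meanIndicator n + s ≤ absIndicator f)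
    (fun f => t * absIndicator f) (t * (meanIndicator n + s)) fun f hf =>
      mul_le_mul_of_nonneg_left hf (by positivity)).trans (sum_exp_absIndicator_le n t)
  rw [← le_div_iff₀ (Real.exp_pos _), mul_div_assoc, ← Real.exp_sub] at h
  refine h.trans_eq ?_
  congr 2
  rw [ht]; field_simp; ring

/-- The lower tail of the absolute indicator. -/
theorem card_absIndicator_le_sub (n : ℕ) {s : ℝ} (hs : 0 ≤ s) :
    ((Finset.univ.filter fun f : BoolFun n => (absIndicator f : ℝ) ≤ meanIndicator n - s).card : ℝ)
      ≤ 2 ^ 2 ^ n * Real.exp (-(s ^ 2 / (8 * 2 ^ n))) := by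
  have hN : (0 : ℝ) < 2 ^ n := by positivity
  set t := s / (4 * 2 ^ n) with ht
  have ht0 : 0 ≤ t := by positivity
  have h := (card_mul_exp_le_sum (fun f : BoolFun n => (absIndicator f : ℝ) ≤ meanIndicator n - s)
    (fun f => -t * absIndicator f) (-t * (meanIndicator n - s)) fun f hf =>
      mul_le_mul_of_nonpos_left hf (by linarith)).trans (sum_exp_absIndicator_le n (-t))
  rw [← le_div_iff₀ (Real.exp_pos _), mul_div_assoc, ← Real.exp_sub] at h
  refine h.trans_eq ?_
  congr 2
  rw [ht]; field_simp; ring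

/-! ### Upper bound for the mean -/

/-- The first-moment bound for the mean. -/
theorem exp_meanIndicator_le (n : ℕ) (t : ℝ) (hn : n ≠ 0) :
    Real.exp (t * meanIndicator n) ≤ 2 * 2 ^ n * Real.exp (t ^ 2 * 2 ^ n) := by
  have hN : (0 : ℝ) < 2 ^ 2 ^ n := by positivity
  have h1 : 2 ^ 2 ^ n * Real.exp (t * meanIndicator n) ≤
      ∑ f : BoolFun n, Real.exp (t * absIndicator f) := by
    -- Jensen's inequality: `exp` lies above its tangent line at `t * meanIndicator n`, and the
    -- linear term averages to zero.
    have h (f : BoolFun n) : Real.exp (t * meanIndicator n) *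
        (t * absIndicator f - t * meanIndicator n + 1) ≤ Real.exp (t * absIndicator f) := by
      have := mul_le_mul_of_nonneg_left
        (Real.add_one_le_exp (t * absIndicator f - t * meanIndicator n))
        (Real.exp_pos (t * meanIndicator n)).le
      rwa [← Real.exp_add, add_sub_cancel] at this
    refine le_trans (le_of_eq ?_) (Finset.sum_le_sum fun f _ => h f)
    rw [← Finset.mul_sum, Finset.sum_add_distrib, Finset.sum_sub_distrib, ← Finset.mul_sum]
    simp only [Finset.sum_const, Finset.card_univ, card_boolFun, nsmul_eq_mul]
    have : ∑ f : BoolFun n, (absIndicator f : ℝ) = 2 ^ 2 ^ n * meanIndicator n := by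
      rw [meanIndicator]; field_simp
    rw [this]; push_cast; ring
  have h2 (f : BoolFun n) : Real.exp (t * absIndicator f) ≤
      ∑ u ∈ Finset.univ.filter fun u : F2 n => u ≠ 0,
        (Real.exp (t * autocorr f u) + Real.exp (-t * autocorr f u)) := by
    -- For `n = 0` there is no nonzero `u`, and the default supremum `0` is not attained.
    have hne : (Finset.univ.filter fun u : F2 n => u ≠ 0).Nonempty :=
      ⟨fun _ => 1, by
        have := NeZero.mk hn
        simpa using fun h => one_ne_zero (α := ZMod 2) (congrFun h 0)⟩
    obtain ⟨u, hu, hfu⟩ := Finset.exists_mem_eq_sup _ hne fun u => (autocorr f u).natAbs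
    refine le_trans ?_ (Finset.single_le_sum (f := fun u => Real.exp (t * autocorr f u) +
      Real.exp (-t * autocorr f u)) (fun v _ => by positivity) hu)
    rw [absIndicator, hfu, Nat.cast_natAbs]
    rcases abs_choice (autocorr f u) with h | h <;> rw [h]
    · linarith [Real.exp_pos (-t * autocorr f u)]
    · push_cast
      rw [mul_neg, ← neg_mul]
      linarith [Real.exp_pos (t * autocorr f u)]
  have h3 : ∑ f : BoolFun n, Real.exp (t * absIndicator f) ≤
      2 ^ n * (2 * (2 ^ 2 ^ n * Real.exp (t ^ 2 * 2 ^ n))) := by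
    refine (Finset.sum_le_sum fun f _ => h2 f).trans ?_
    rw [Finset.sum_comm]
    have h4 : ∀ u ∈ Finset.univ.filter fun u : F2 n => u ≠ 0,
        ∑ f : BoolFun n, (Real.exp (t * autocorr f u) + Real.exp (-t * autocorr f u)) ≤
          2 * (2 ^ 2 ^ n * Real.exp (t ^ 2 * 2 ^ n)) := by
      intro u hu
      have hu := (Finset.mem_filter.1 hu).2
      rw [Finset.sum_add_distrib]
      have a1 := sum_exp_autocorr hu t
      have a2 := sum_exp_autocorr hu (-t)
      rw [neg_sq] at a2
      linarith
    refine (Finset.sum_le_card_nsmul _ _ _ h4).trans ?_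
    rw [nsmul_eq_mul]
    gcongr
    have : (Finset.univ.filter fun u : F2 n => u ≠ 0).card ≤ 2 ^ n := by
      refine (Finset.card_le_univ _).trans_eq ?_
      simp [ZMod.card]
    exact_mod_cast this
  have h5 := h1.trans h3
  refine le_of_mul_le_mul_left (h5.trans_eq ?_) hN
  ring

/-! ### Binomial lower bound for the tail of one autocorrelation -/

/-- The distribution of `autocorr f u`: a sum over the binomial distribution. -/
theorem sum_autocorr {n M : ℕ} (hM : M * 2 = 2 ^ n) {u : F2 n} (hu : u ≠ 0) (F : ℤ → ℝ) :
    ∑ f : BoolFun n, F (autocorr f u) =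
      2 ^ M * ∑ k ∈ Finset.range (M + 1), (M.choose k : ℝ) * F (2 * (2 * k - M)) := by
  classical
  obtain ⟨Q, _, e, he⟩ := exists_line_equiv hu
  have hQ : Fintype.card Q = M := by have := card_line e; omega
  -- The second component records, for each coset, whether `f` is constant on it, and alone
  -- determines the autocorrelation; the free first component gives the factor `2 ^ M`.
  let E : BoolFun n ≃ (Q → ZMod 2) × (Q → ZMod 2) :=
    { toFun := fun f => (fun q => f (e (q, 0)), fun q => f (e (q, 0)) + f (e (q, 1)))
      invFun := fun p x => if (e.symm x).2 = 0 then p.1 (e.symm x).1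
        else p.1 (e.symm x).1 + p.2 (e.symm x).1
      left_inv := fun f => by
        funext x
        obtain ⟨⟨q, k⟩, rfl⟩ := e.surjective x
        simp only [Equiv.symm_apply_apply]
        have h (a b : ZMod 2) : a + (a + b) = b := by revert a b; decide
        fin_cases k
        · rfl
        · exact h _ _
      right_inv := fun p => by
        have h (a b : ZMod 2) : a + (a + b) = b := by revert a b; decide
        ext q <;> simp [h] }
  let S : (Q → ZMod 2) ≃ Finset Q :=
    { toFun := fun b => Finset.univ.filter fun q => b q = 0
      invFun := fun s q => if q ∈ s then 0 else 1
      left_inv := fun b => by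
        funext q
        have h (a : ZMod 2) : (if a = 0 then 0 else 1) = a := by revert a; decide
        simp [h]
      right_inv := fun s => by ext q; simp }
  have hE (f : BoolFun n) : autocorr f u = 2 * (2 * ((S (E f).2).card : ℤ) - M) := by
    have h (a : ZMod 2) : sgn a = 2 * (if a = 0 then 1 else 0) - 1 := by revert a; decide
    rw [autocorr_line e he]
    simp only [mul_assoc, ← sgn_add]
    simp only [h]
    rw [← Finset.mul_sum, Finset.sum_sub_distrib, ← Finset.mul_sum, Finset.sum_boole]
    simp [E, S, hQ]
  simp only [hE]
  rw [E.sum_comp fun p => F (2 * (2 * ((S p.2).card : ℤ) - M)), Fintype.sum_prod_type]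
  dsimp only
  rw [S.sum_comp fun s => F (2 * (2 * (s.card : ℤ) - M))]
  rw [← Finset.powerset_univ, Finset.sum_powerset_apply_card fun k => F (2 * (2 * (k : ℤ) - M))]
  simp [hQ, ZMod.card]

theorem four_pow_le_sqrt_mul_centralBinom {m : ℕ} (hm : 1 ≤ m) :
    (4 : ℝ) ^ m ≤ 2 * Real.sqrt m * m.centralBinom := by
  -- The squared inequality is free of roots and passes through the induction.
  have h : (16 : ℝ) ^ m ≤ 4 * m * m.centralBinom ^ 2 := by
    induction m, hm using Nat.le_induction with
    | base => norm_num [Nat.centralBinom]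
    | succ m hm ih =>
      have h1 : ((m : ℝ) + 1) * (m + 1).centralBinom = 2 * (2 * m + 1) * m.centralBinom := by
        exact_mod_cast Nat.succ_mul_centralBinom_succ m
      have h2 : (0 : ℝ) < m + 1 := by positivity
      rw [pow_succ]
      push_cast
      refine le_of_mul_le_mul_left ?_ h2
      have h3 : ((m : ℝ) + 1) * (4 * (m + 1) * (m + 1).centralBinom ^ 2) =
          4 * (2 * (2 * m + 1) * m.centralBinom) ^ 2 := by rw [← h1]; ring
      rw [h3]
      nlinarith [sq_nonneg (m.centralBinom : ℝ)]
  refine (pow_le_pow_iff_left₀ (by positivity) (by positivity) two_ne_zero).1 ?_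
  rw [← pow_mul, mul_comm m 2, pow_mul, mul_pow, mul_pow, Real.sq_sqrt (by positivity)]
  norm_num
  linarith

/-- Consecutive coefficients have ratio `(m - j) / (m + j + 1) ≥ exp (-(2 * j + 1) / (m - j))`.
Replacing the last denominator by `m - J` lets the exponents add up, and the odd numbers sum to `j ^
2`. -/
theorem centralBinom_mul_exp_le_choose {m J : ℕ} (hJ : J < m) {j : ℕ} (hj : j ≤ J) :
    m.centralBinom * Real.exp (-((j : ℝ) ^ 2 / (m - J))) ≤ (2 * m).choose (m + j) := by
  have hmJ : (0 : ℝ) < m - J := by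
    have : (J : ℝ) < m := by exact_mod_cast hJ
    linarith
  induction j with
  | zero => simp [Nat.centralBinom]
  | succ j ih =>
    have ih := ih (by omega)
    have h1 : ((2 * m).choose (m + j + 1) : ℝ) * (m + j + 1) = (2 * m).choose (m + j) * (m - j) := by
      have := Nat.choose_succ_right_eq (2 * m) (m + j)
      rw [show 2 * m - (m + j) = m - j by omega] at this
      rw [← Nat.cast_sub (by omega)]
      exact_mod_cast this
    have hjm : (j : ℝ) + 1 ≤ J := by exact_mod_cast hj
    have hmj : (0 : ℝ) < m - j := by linarith
    have h2 : Real.exp (-((2 * j + 1) / (m - J))) * (m + j + 1) ≤ m - j := by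
      have h3 : (m + j + 1) / ((m : ℝ) - j) ≤ Real.exp ((2 * j + 1) / (m - J)) := by
        refine le_trans ?_ (Real.add_one_le_exp _)
        have : (2 * j + 1) / ((m : ℝ) - j) ≤ (2 * j + 1) / (m - J) := by gcongr; linarith
        refine le_trans (le_of_eq ?_) (add_le_add_left this 1)
        field_simp
        ring
      rw [div_le_iff₀ hmj] at h3
      rw [Real.exp_neg, inv_mul_le_iff₀ (Real.exp_pos _)]
      exact h3
    have h4 : (0 : ℝ) < m + j + 1 := by positivity
    refine le_of_mul_le_mul_right ?_ h4
    rw [← add_assoc, h1]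
    calc _ = (m.centralBinom * Real.exp (-((j : ℝ) ^ 2 / (m - J)))) *
          (Real.exp (-((2 * j + 1) / (m - J))) * (m + j + 1)) := by
          have : Real.exp (-(((j + 1 : ℕ) : ℝ) ^ 2 / (m - J))) =
              Real.exp (-((j : ℝ) ^ 2 / (m - J))) * Real.exp (-((2 * j + 1) / (m - J))) := by
            rw [← Real.exp_add]; push_cast; ring_nf
          rw [this]; ring
      _ ≤ _ := by gcongr

/-- A lower bound for the upper tail of `autocorr f u`. -/
theorem le_card_le_autocorr {n m j w : ℕ} (hm : m * 4 = 2 ^ n) {u : F2 n} (hu : u ≠ 0)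
    (hw : Real.sqrt m ≤ w) (hj : j + w < m) :
    2 ^ 2 ^ n * (1 / 2 * Real.exp (-(((j + w : ℕ) : ℝ) ^ 2 / (m - (j + w : ℕ))))) ≤
      ((Finset.univ.filter fun f : BoolFun n => 4 * (j : ℤ) ≤ autocorr f u).card : ℝ) := by
  have h := sum_autocorr (n := n) (M := 2 * m) (by omega) hu fun z => if 4 * (j : ℤ) ≤ z then 1 else 0
  rw [Finset.sum_boole] at h
  rw [h]
  set c := Real.exp (-(((j + w : ℕ) : ℝ) ^ 2 / (m - (j + w : ℕ)))) with hc
  have hmJ : (0 : ℝ) < m - (j + w : ℕ) := by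
    have : ((j + w : ℕ) : ℝ) < m := by exact_mod_cast hj
    linarith
  -- Only the `w` coefficients with `m + j ≤ k < m + j + w` are kept. Since `w ≥ √m`, their number
  -- makes up for the factor `√m` in `four_pow_le_sqrt_mul_centralBinom`.
  have h1 : (w : ℝ) * (m.centralBinom * c) ≤ ∑ k ∈ Finset.range (2 * m + 1),
      ((2 * m).choose k : ℝ) *
        (if 4 * (j : ℤ) ≤ 2 * (2 * (k : ℤ) - (2 * m : ℕ)) then 1 else 0) := by
    calc (w : ℝ) * (m.centralBinom * c)
        = ∑ i ∈ Finset.range w, m.centralBinom * c := by simp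
      _ ≤ ∑ i ∈ Finset.range w, ((2 * m).choose (m + (j + i)) : ℝ) *
            (if 4 * (j : ℤ) ≤ 2 * (2 * ((m + (j + i) : ℕ) : ℤ) - (2 * m : ℕ)) then 1 else 0) := by
          refine Finset.sum_le_sum fun i hi => ?_
          have hi := Finset.mem_range.1 hi
          rw [if_pos (by push_cast; omega), mul_one]
          refine le_trans ?_ (centralBinom_mul_exp_le_choose hj (j := j + i) (by omega))
          rw [hc]
          gcongr
      _ = ∑ k ∈ (Finset.range w).map ⟨fun i => m + (j + i), fun a b h => by simpa using h⟩,
            ((2 * m).choose k : ℝ) *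
              (if 4 * (j : ℤ) ≤ 2 * (2 * (k : ℤ) - (2 * m : ℕ)) then 1 else 0) := by
          rw [Finset.sum_map]; rfl
      _ ≤ _ := by
          refine Finset.sum_le_sum_of_subset_of_nonneg (fun k hk => ?_) fun k _ _ => by positivity
          obtain ⟨i, hi, rfl⟩ := Finset.mem_map.1 hk
          have hi := Finset.mem_range.1 hi
          change m + (j + i) ∈ _
          rw [Finset.mem_range]
          omega
  have h2 := four_pow_le_sqrt_mul_centralBinom (m := m) (by omega)
  have h3 : (4 : ℝ) ^ m * (1 / 2 * c) ≤ w * (m.centralBinom * c) := by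
    have : 2 * Real.sqrt m * m.centralBinom ≤ 2 * w * m.centralBinom := by gcongr
    have := mul_le_mul_of_nonneg_right (h2.trans this) (show 0 ≤ c / 2 by positivity)
    linarith
  have h4 : (2 : ℝ) ^ 2 ^ n = 2 ^ (2 * m) * 4 ^ m := by
    rw [← hm, show (4 : ℝ) = 2 ^ 2 by norm_num, ← pow_mul, ← pow_add]
    congr 1; omega
  rw [h4, mul_assoc]
  gcongr
  exact h3.trans h1

/-! ### Second moment method -/

/-- The second moment method for a finite family of events with small pairwise correlations. -/
theorem one_le_card_exists_mul {α β : Type} [Fintype α] [DecidableEq β] (U : Finset β)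
    (A : β → α → Prop) [∀ u, DecidablePred (A u)] [DecidablePred fun x => ∃ u ∈ U, A u x]
    {T q p : ℝ} (hT : 0 < T) (hq : 0 < q) (hp : 0 ≤ p) (hU : U.Nonempty)
    (h1 : ∀ u ∈ U, T * q ≤ (Finset.univ.filter (A u)).card)
    (h2 : ∀ u ∈ U, ∀ v ∈ U, u ≠ v →
      ((Finset.univ.filter fun x => A u x ∧ A v x).card : ℝ) ≤ T * p) :
    T ≤ (Finset.univ.filter fun x => ∃ u ∈ U, A u x).card * (1 / (U.card * q) + p / q ^ 2) := by
  set S := Finset.univ.filter fun x => ∃ u ∈ U, A u x with hS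
  let X : α → ℝ := fun x => ∑ u ∈ U, if A u x then 1 else 0
  have hX0 : ∀ x ∉ S, X x = 0 := fun x hx => Finset.sum_eq_zero fun u hu =>
    if_neg fun h => hx (Finset.mem_filter.2 ⟨Finset.mem_univ _, u, hu, h⟩)
  -- Cauchy–Schwarz for the number `X` of events that occur, which vanishes off `S`.
  have hc := sq_sum_le_card_mul_sum_sq (s := S) (f := X)
  rw [Finset.sum_subset (Finset.subset_univ S) fun x _ hx => hX0 x hx,
    Finset.sum_subset (Finset.subset_univ S) fun x _ hx => by rw [hX0 x hx]; norm_num] at hc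
  have hX1 : ∑ x, X x = ∑ u ∈ U, ((Finset.univ.filter (A u)).card : ℝ) := by
    rw [Finset.sum_comm]
    exact Finset.sum_congr rfl fun u _ => Finset.sum_boole _ _
  have hX2 : ∑ x, X x ^ 2 ≤ ∑ x, X x + (U.card : ℝ) ^ 2 * (T * p) := by
    have e : ∑ x, X x ^ 2 =
        ∑ u ∈ U, ∑ v ∈ U, ((Finset.univ.filter fun x => A u x ∧ A v x).card : ℝ) := by
      simp only [X, sq, Finset.sum_mul_sum]
      rw [Finset.sum_comm]
      refine Finset.sum_congr rfl fun u _ => ?_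
      rw [Finset.sum_comm]
      refine Finset.sum_congr rfl fun v _ => ?_
      rw [← Finset.sum_boole]
      refine Finset.sum_congr rfl fun x _ => ?_
      by_cases h : A u x <;> by_cases h' : A v x <;> simp [h, h']
    rw [e, hX1, sq, mul_assoc, ← nsmul_eq_mul, ← Finset.sum_const, ← Finset.sum_add_distrib]
    refine Finset.sum_le_sum fun u hu => ?_
    rw [← Finset.add_sum_erase _ _ hu]
    simp only [and_self]
    gcongr
    refine (Finset.sum_le_card_nsmul _ _ (T * p) fun v hv => h2 u hu v (Finset.mem_erase.1 hv).2
      (Finset.mem_erase.1 hv).1.symm).trans ?_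
    rw [nsmul_eq_mul]
    gcongr
    exact Finset.erase_subset _ _
  have hK : (0 : ℝ) < U.card := by exact_mod_cast hU.card_pos
  set s := ∑ x, X x with hs
  set K : ℝ := (U.card : ℝ)
  have hs1 : K * (T * q) ≤ s := by
    rw [hX1, ← nsmul_eq_mul]
    exact Finset.card_nsmul_le_sum _ _ _ h1
  have hs0 : 0 < s := lt_of_lt_of_le (by positivity) hs1
  have h3 : s ^ 2 ≤ S.card * (s + K ^ 2 * (T * p)) :=
    hc.trans (mul_le_mul_of_nonneg_left hX2 (Nat.cast_nonneg _))
  have h4 : T ≤ S.card * (T / s + K ^ 2 * (T * p) * T / s ^ 2) := by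
    have := mul_le_mul_of_nonneg_right h3 (show 0 ≤ T / s ^ 2 by positivity)
    calc T = s ^ 2 * (T / s ^ 2) := by field_simp
      _ ≤ _ := this
      _ = _ := by field_simp
  refine h4.trans (mul_le_mul_of_nonneg_left (add_le_add ?_ ?_) (Nat.cast_nonneg _))
  · rw [div_le_div_iff₀ hs0 (by positivity)]
    linarith
  · rw [div_le_div_iff₀ (by positivity) (by positivity)]
    have : (K * (T * q)) ^ 2 ≤ s ^ 2 := by gcongr
    calc K ^ 2 * (T * p) * T * q ^ 2 = p * (K * (T * q)) ^ 2 := by ring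
      _ ≤ p * s ^ 2 := by gcongr

/-! ### Asymptotics at the scale `√(2ⁿ log 2ⁿ)` -/

/-- The natural logarithm of `2ⁿ`. -/
noncomputable def logCard (n : ℕ) : ℝ := Real.log ((2 : ℝ) ^ n)

/-- The normalization `√(2ⁿ log 2ⁿ)`. -/
noncomputable def scale (n : ℕ) : ℝ := Real.sqrt ((2 : ℝ) ^ n * logCard n)

theorem exp_logCard (n : ℕ) : Real.exp (logCard n) = 2 ^ n := Real.exp_log (by positivity)

theorem logCard_pos {n : ℕ} (hn : n ≠ 0) : 0 < logCard n :=
  Real.log_pos (one_lt_pow₀ one_lt_two hn)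

theorem tendsto_logCard : Tendsto logCard atTop atTop :=
  Real.tendsto_log_atTop.comp (tendsto_pow_atTop_atTop_of_one_lt one_lt_two)

theorem tendsto_logCard_pow_div (k : ℕ) :
    Tendsto (fun n => logCard n ^ k / 2 ^ n) atTop (𝓝 0) := by
  refine ((Real.tendsto_pow_mul_exp_neg_atTop_nhds_zero k).comp tendsto_logCard).congr fun n => ?_
  simp only [Function.comp]
  rw [Real.exp_neg, exp_logCard]; rfl

theorem scale_sq (n : ℕ) : scale n ^ 2 = 2 ^ n * logCard n :=
  Real.sq_sqrt (mul_nonneg (by positivity) (Real.log_nonneg (one_le_pow₀ one_le_two)))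

theorem scale_pos {n : ℕ} (hn : n ≠ 0) : 0 < scale n :=
  Real.sqrt_pos.2 (mul_pos (by positivity) (logCard_pos hn))

theorem eventually_le_card_le_autocorr {a b : ℝ} (ha : 0 ≤ a) (hab : a ^ 2 < b) :
    ∀ᶠ n : ℕ in atTop, ∀ u : F2 n, u ≠ 0 → 2 ^ 2 ^ n * Real.exp (-(b * logCard n)) ≤
      ((Finset.univ.filter fun f : BoolFun n =>
        2 * a * scale n ≤ (autocorr f u : ℝ)).card : ℝ) := by
  set y : ℕ → ℝ := fun n => Real.sqrt ((2 : ℝ) ^ n / 4) with hy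
  set z : ℕ → ℝ := fun n => Real.sqrt (logCard n) with hz
  -- `J` bounds `j + w` below, the `2` paying for two ceilings; `y n` is `√m` with `m = 2 ^ n / 4`,
  -- and `scale n = 2 * y n * z n`.
  set J : ℕ → ℝ := fun n => a * (y n * z n) + y n + 2 with hJ
  have hy0 (n : ℕ) : 0 < y n := Real.sqrt_pos.2 (by positivity)
  have hy2 (n : ℕ) : y n ^ 2 = 2 ^ n / 4 := Real.sq_sqrt (by positivity)
  have hz2 (n : ℕ) : z n ^ 2 = logCard n :=
    Real.sq_sqrt (Real.log_nonneg (one_le_pow₀ one_le_two))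
  have hyi : Tendsto (fun n => (y n)⁻¹) atTop (𝓝 0) :=
    (Real.tendsto_sqrt_atTop.comp ((tendsto_pow_atTop_atTop_of_one_lt
      one_lt_two).atTop_div_const (by norm_num))).inv_tendsto_atTop
  have hzt : Tendsto z atTop atTop := Real.tendsto_sqrt_atTop.comp tendsto_logCard
  have hzi : Tendsto (fun n => (z n)⁻¹) atTop (𝓝 0) := hzt.inv_tendsto_atTop
  have hzy : Tendsto (fun n => z n * (y n)⁻¹) atTop (𝓝 0) := by
    have h := ((tendsto_logCard_pow_div 1).const_mul 4).sqrt
    rw [mul_zero, Real.sqrt_zero] at h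
    refine h.congr fun n => ?_
    rw [← div_eq_mul_inv, hz, hy, ← Real.sqrt_div' _ (by positivity)]
    congr 1; field_simp
  have h1 : Tendsto (fun n => a + (z n)⁻¹ + 2 * ((y n)⁻¹ * (z n)⁻¹)) atTop (𝓝 a) := by
    simpa using (tendsto_const_nhds.add hzi).add ((hyi.mul hzi).const_mul 2)
  have h2 : Tendsto (fun n => 1 - (a * (z n * (y n)⁻¹) + (y n)⁻¹ + 2 * ((y n)⁻¹ * (y n)⁻¹)))
      atTop (𝓝 1) := by
    simpa using tendsto_const_nhds.sub
      (((hzy.const_mul a).add hyi).add ((hyi.mul hyi).const_mul 2))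
  have h3 : Tendsto (fun n => Real.log 2 * ((z n)⁻¹ * (z n)⁻¹)) atTop (𝓝 0) := by
    simpa using (hzi.mul hzi).const_mul (Real.log 2)
  have h4 := ((h1.pow 2).div h2 one_ne_zero).add h3
  rw [div_one, add_zero] at h4
  filter_upwards [h4.eventually_lt_const hab, h2.eventually_const_lt zero_lt_one,
    hzt.eventually_gt_atTop 0, eventually_ge_atTop 2] with n hn1 hn2 hzn hn u hu
  obtain ⟨d, rfl⟩ := Nat.exists_eq_add_of_le' hn
  set m : ℕ := 2 ^ d with hm
  have hm4 : m * 4 = 2 ^ (d + 2) := by rw [pow_add, hm]; norm_num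
  have hmy : (m : ℝ) = y (d + 2) ^ 2 := by
    rw [hy2, hm, pow_add]; push_cast; ring
  set Y := y (d + 2) with hY
  set Z := z (d + 2) with hZ
  have hY0 : 0 < Y := hy0 _
  set j := ⌈a * (Y * Z)⌉₊ with hj
  set w := ⌈Y⌉₊ with hw
  have hjw : ((j + w : ℕ) : ℝ) ≤ J (d + 2) := by
    have h1 := (Nat.ceil_lt_add_one (show 0 ≤ a * (Y * Z) by positivity)).le
    have h2 := (Nat.ceil_lt_add_one hY0.le).le
    push_cast
    simp only [hJ]
    linarith
  have hJm : (m : ℝ) - J (d + 2) =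
      Y ^ 2 * (1 - (a * (Z * Y⁻¹) + Y⁻¹ + 2 * (Y⁻¹ * Y⁻¹))) := by
    rw [hmy]; simp only [hJ]; rw [← hY, ← hZ]; field_simp
  have hJ0 : J (d + 2) = Y * Z * (a + Z⁻¹ + 2 * (Y⁻¹ * Z⁻¹)) := by
    simp only [hJ]; rw [← hY, ← hZ]; field_simp
  have hJlt : 0 < (m : ℝ) - J (d + 2) := by rw [hJm]; positivity
  have hscale : 2 * a * scale (d + 2) = 4 * (a * (Y * Z)) := by
    have : scale (d + 2) = 2 * (Y * Z) := by
      refine (pow_left_inj₀ (Real.sqrt_nonneg _) (by positivity) two_ne_zero).1 ?_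
      rw [← scale, scale_sq, mul_pow, mul_pow, hY, hZ, hy2, hz2]; ring
    rw [this]; ring
  have hlt : j + w < m := by
    have : ((j + w : ℕ) : ℝ) < m := by linarith
    exact_mod_cast this
  have hsq : Real.sqrt m ≤ w := by
    rw [hmy, Real.sqrt_sq hY0.le]; exact Nat.le_ceil _
  refine le_trans ?_ ((le_card_le_autocorr hm4 hu hsq hlt).trans ?_)
  · gcongr
    have e : (1 / 2 : ℝ) = Real.exp (-Real.log 2) := by
      rw [Real.exp_neg, Real.exp_log two_pos]; norm_num
    rw [e, ← Real.exp_add, Real.exp_le_exp]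
    have h5 : ((j + w : ℕ) : ℝ) ^ 2 / (m - (j + w : ℕ)) ≤ J (d + 2) ^ 2 / (m - J (d + 2)) := by
      gcongr
    -- The cost is `logCard` times a factor tending to `a ^ 2`, the lost `1/2` included, so it is
    -- eventually below `b * logCard`.
    have h6 : J (d + 2) ^ 2 / (m - J (d + 2)) + Real.log 2 = Z ^ 2 *
        ((a + Z⁻¹ + 2 * (Y⁻¹ * Z⁻¹)) ^ 2 / (1 - (a * (Z * Y⁻¹) + Y⁻¹ + 2 * (Y⁻¹ * Y⁻¹))) +
          Real.log 2 * (Z⁻¹ * Z⁻¹)) := by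
      rw [hJm, hJ0]
      generalize (1 - (a * (Z * Y⁻¹) + Y⁻¹ + 2 * (Y⁻¹ * Y⁻¹))) = D at hn2 ⊢
      generalize (a + Z⁻¹ + 2 * (Y⁻¹ * Z⁻¹)) = C
      field_simp
    have h7 : J (d + 2) ^ 2 / (m - J (d + 2)) + Real.log 2 ≤ b * logCard (d + 2) := by
      rw [h6, ← hz2, mul_comm b]
      exact mul_le_mul_of_nonneg_left hn1.le (sq_nonneg Z)
    linarith
  · have : (Finset.univ.filter fun f : BoolFun (d + 2) => 4 * (j : ℤ) ≤ autocorr f u) ⊆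
        Finset.univ.filter fun f => 2 * a * scale (d + 2) ≤ (autocorr f u : ℝ) := by
      intro f hf
      simp only [Finset.mem_filter, Finset.mem_univ, true_and] at hf ⊢
      rw [hscale]
      have h8 : (4 * j : ℝ) ≤ autocorr f u := by exact_mod_cast hf
      have h9 : a * (Y * Z) ≤ j := Nat.le_ceil _
      linarith
    exact_mod_cast Finset.card_le_card this

theorem eventually_card_autocorr_and_le {a : ℝ} (ha : 0 ≤ a) :
    ∀ᶠ n : ℕ in atTop, ∀ u v : F2 n, u ≠ 0 → v ≠ 0 → u ≠ v →
      ((Finset.univ.filter fun f : BoolFun n => 2 * a * scale n ≤ (autocorr f u : ℝ) ∧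
        2 * a * scale n ≤ (autocorr f v : ℝ)).card : ℝ) ≤
      2 ^ 2 ^ n * (2 * Real.exp (-(2 * a ^ 2 * logCard n))) := by
  have h1 : Tendsto (fun n => 32 * a ^ 2 * (logCard n ^ 1 / 2 ^ n)) atTop (𝓝 0) := by
    simpa using (tendsto_logCard_pow_div 1).const_mul (32 * a ^ 2)
  have h2 : Tendsto (fun n => 64 * a ^ 4 * (logCard n ^ 2 / 2 ^ n)) atTop (𝓝 0) := by
    simpa using (tendsto_logCard_pow_div 2).const_mul (64 * a ^ 4)
  filter_upwards [h1.eventually_le_const zero_lt_one,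
    h2.eventually_le_const (Real.log_pos one_lt_two)] with n hn1 hn2 u v hu hv huv
  have hN : (0 : ℝ) < 2 ^ n := by positivity
  -- This `t` minimizes `2 * t ^ 2 * 2 ^ n - 4 * a * t * scale n`. The quartic remainder is at most
  -- `log 2`, whence the factor `2` in the bound.
  set t := a * (scale n / 2 ^ n) with ht
  have ht0 : 0 ≤ t := mul_nonneg ha (div_nonneg (Real.sqrt_nonneg _) hN.le)
  have ht2 : t ^ 2 = a ^ 2 * (logCard n / 2 ^ n) := by
    rw [ht, mul_pow, div_pow, scale_sq]; field_simp
  have hts : t * scale n = a * logCard n := by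
    have : t * scale n = a * (scale n ^ 2 / 2 ^ n) := by rw [ht]; ring
    rw [this, scale_sq]; field_simp
  have h := (card_mul_exp_le_sum (fun f : BoolFun n => 2 * a * scale n ≤ (autocorr f u : ℝ) ∧
      2 * a * scale n ≤ (autocorr f v : ℝ)) (fun f => t * (autocorr f u + autocorr f v))
      (t * (4 * a * scale n)) fun f hf =>
        mul_le_mul_of_nonneg_left (by linarith [hf.1, hf.2]) ht0).trans
    (sum_exp_autocorr_add hu hv huv (by rw [ht2]; simpa [mul_assoc] using hn1))
  rw [← le_div_iff₀ (Real.exp_pos _), mul_div_assoc, ← Real.exp_sub] at h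
  refine h.trans ?_
  gcongr
  rw [show (2 : ℝ) * Real.exp (-(2 * a ^ 2 * logCard n)) =
    Real.exp (Real.log 2 + -(2 * a ^ 2 * logCard n)) by rw [Real.exp_add, Real.exp_log two_pos]]
  rw [Real.exp_le_exp]
  have e1 : t * (4 * a * scale n) = 4 * a ^ 2 * logCard n := by
    rw [show t * (4 * a * scale n) = 4 * a * (t * scale n) by ring, hts]; ring
  have e2 : 2 * t ^ 2 * 2 ^ n = 2 * a ^ 2 * logCard n := by rw [ht2]; field_simp
  have e3 : 64 * t ^ 4 * 2 ^ n = 64 * a ^ 4 * (logCard n ^ 2 / 2 ^ n) := by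
    rw [show t ^ 4 = (t ^ 2) ^ 2 by ring, ht2]; field_simp
  rw [e1, e2, e3]
  linarith

theorem card_ne_zero_F2 (n : ℕ) :
    ((Finset.univ.filter fun u : F2 n => u ≠ 0).card : ℝ) = 2 ^ n - 1 := by
  rw [Finset.filter_ne' Finset.univ (0 : F2 n), Finset.card_erase_of_mem (Finset.mem_univ _),
    Finset.card_univ, Nat.cast_sub Fintype.card_pos]
  simp [ZMod.card]

/-- Up to an arbitrarily small power of `2ⁿ`, large values of the indicator are not rare. -/
theorem eventually_le_card_le_absIndicator {a δ : ℝ} (ha : 0 ≤ a) (ha1 : a < 1) (hδ : 0 < δ) :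
    ∀ᶠ n : ℕ in atTop, 2 ^ 2 ^ n * (1 / 4 * Real.exp (-(δ * logCard n))) ≤
      ((Finset.univ.filter fun f : BoolFun n =>
        2 * a * scale n ≤ (absIndicator f : ℝ)).card : ℝ) := by
  -- `b ≤ 1` keeps the expected number of events bounded below; `b ≤ a ^ 2 + δ / 2` keeps the
  -- correlation ratio `p / q ^ 2` below `2 * exp (δ * logCard n)`.
  set b := min 1 (a ^ 2 + δ / 2) with hb
  have hab : a ^ 2 < b := lt_min (by nlinarith) (by linarith)
  filter_upwards [eventually_le_card_le_autocorr ha hab, eventually_card_autocorr_and_le ha,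
    eventually_ge_atTop 1] with n h1 h2 hn
  have hL := logCard_pos (n := n) (by omega)
  have hN : (2 : ℝ) ≤ 2 ^ n := by simpa using pow_le_pow_right₀ one_le_two hn
  set U := Finset.univ.filter fun u : F2 n => u ≠ 0 with hU
  have hUc : (U.card : ℝ) = 2 ^ n - 1 := card_ne_zero_F2 n
  have hUne : U.Nonempty := by
    rw [← Finset.card_pos]
    have : (0 : ℝ) < U.card := by rw [hUc]; linarith
    exact_mod_cast this
  classical
  have h := one_le_card_exists_mul U
    (fun u (f : BoolFun n) => 2 * a * scale n ≤ (autocorr f u : ℝ))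
    (T := 2 ^ 2 ^ n) (q := Real.exp (-(b * logCard n)))
    (p := 2 * Real.exp (-(2 * a ^ 2 * logCard n)))
    (by positivity) (Real.exp_pos _) (by positivity) hUne
    (fun u hu => h1 u (Finset.mem_filter.1 hu).2)
    (fun u hu v hv huv => h2 u v (Finset.mem_filter.1 hu).2 (Finset.mem_filter.1 hv).2 huv)
  have hsub : (Finset.univ.filter fun f : BoolFun n =>
      ∃ u ∈ U, 2 * a * scale n ≤ (autocorr f u : ℝ)) ⊆
      Finset.univ.filter fun f : BoolFun n => 2 * a * scale n ≤ (absIndicator f : ℝ) := by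
    intro f hf
    simp only [Finset.mem_filter, Finset.mem_univ, true_and] at hf ⊢
    obtain ⟨u, hu, hfu⟩ := hf
    refine hfu.trans ?_
    have h3 : autocorr f u ≤ (absIndicator f : ℤ) :=
      Int.le_natAbs.trans (Int.ofNat_le.2
        (Finset.le_sup (f := fun u => (autocorr f u).natAbs) hu))
    exact_mod_cast h3
  have hc : ((Finset.univ.filter fun f : BoolFun n =>
      ∃ u ∈ U, 2 * a * scale n ≤ (autocorr f u : ℝ)).card : ℝ) ≤
      (Finset.univ.filter fun f : BoolFun n => 2 * a * scale n ≤ (absIndicator f : ℝ)).card := by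
    exact_mod_cast Finset.card_le_card hsub
  have hb1 : 1 / ((U.card : ℝ) * Real.exp (-(b * logCard n))) ≤ 2 * Real.exp (δ * logCard n) := by
    have h3 : Real.exp (-logCard n) ≤ Real.exp (-(b * logCard n)) := by
      rw [Real.exp_le_exp]; nlinarith [min_le_left 1 (a ^ 2 + δ / 2)]
    rw [Real.exp_neg (logCard n), exp_logCard] at h3
    have h4 : (1 / 2 : ℝ) ≤ U.card * Real.exp (-(b * logCard n)) := by
      calc (1 / 2 : ℝ) = (2 ^ n / 2) * (2 ^ n)⁻¹ := by field_simp
        _ ≤ _ := by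
          rw [hUc]
          gcongr <;> linarith
    have h5 : 1 / ((U.card : ℝ) * Real.exp (-(b * logCard n))) ≤ 2 := by
      rw [div_le_iff₀ (by linarith)]; linarith
    have h6 : 1 ≤ Real.exp (δ * logCard n) := Real.one_le_exp (by positivity)
    linarith
  have hb2 : 2 * Real.exp (-(2 * a ^ 2 * logCard n)) / Real.exp (-(b * logCard n)) ^ 2 ≤
      2 * Real.exp (δ * logCard n) := by
    rw [mul_div_assoc, ← Real.exp_nat_mul, ← Real.exp_sub]
    gcongr
    have := min_le_right 1 (a ^ 2 + δ / 2)
    push_cast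
    nlinarith
  set P := ((Finset.univ.filter fun f : BoolFun n =>
    2 * a * scale n ≤ (absIndicator f : ℝ)).card : ℝ) with hP
  have hfin : (2 : ℝ) ^ 2 ^ n ≤ P * (4 * Real.exp (δ * logCard n)) := by
    refine h.trans (mul_le_mul hc (by linarith) (by positivity) (Nat.cast_nonneg _))
  rw [Real.exp_neg, one_div, ← mul_inv, ← div_eq_mul_inv, div_le_iff₀ (by positivity)]
  exact hfin

theorem eventually_le_meanIndicator {a ε : ℝ} (ha : 0 ≤ a) (ha1 : a < 1) (hε : 0 < ε) :
    ∀ᶠ n : ℕ in atTop, (2 * a - ε) * scale n ≤ meanIndicator n := by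
  -- Half the exponent `ε ^ 2 / 8` of the upper tail at distance `ε * scale n`: were the mean too
  -- small, the two bounds would conflict once `ε ^ 2 / 16 * logCard n > log 4`.
  have hδ : 0 < ε ^ 2 / 16 := by positivity
  have hL := (tendsto_logCard.const_mul_atTop hδ).eventually_gt_atTop (Real.log 4)
  filter_upwards [eventually_le_card_le_absIndicator ha ha1 hδ, hL, eventually_ge_atTop 1]
    with n h1 h2 hn
  by_contra! hlt
  have hs := scale_pos (n := n) (by omega)
  have h3 := card_add_le_absIndicator n (s := ε * scale n) (by positivity)
  have hsub : (Finset.univ.filter fun f : BoolFun n => 2 * a * scale n ≤ (absIndicator f : ℝ)) ⊆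
      Finset.univ.filter fun f : BoolFun n =>
        meanIndicator n + ε * scale n ≤ (absIndicator f : ℝ) := by
    intro f hf
    simp only [Finset.mem_filter, Finset.mem_univ, true_and] at hf ⊢
    linarith
  have h4 := le_of_mul_le_mul_left (h1.trans ((Nat.cast_le.2 (Finset.card_le_card hsub)).trans h3))
    (by positivity)
  have h5 : (ε * scale n) ^ 2 / (8 * 2 ^ n) = 2 * (ε ^ 2 / 16 * logCard n) := by
    rw [mul_pow, scale_sq]; field_simp; ring
  have h6 : (1 / 4 : ℝ) = Real.exp (-Real.log 4) := by
    rw [Real.exp_neg, Real.exp_log (by norm_num)]; norm_num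
  rw [h5, h6, ← Real.exp_add, Real.exp_le_exp] at h4
  linarith

/-- The choice `t = scale n / 2 ^ n` makes `t ^ 2 * 2 ^ n` equal to `logCard n`, balancing it
against the logarithm of the union bound factor `2 ^ n`. -/
theorem meanIndicator_div_scale_le {n : ℕ} (hn : n ≠ 0) :
    meanIndicator n / scale n ≤ 2 + Real.log 2 * (logCard n)⁻¹ := by
  have hs := scale_pos hn
  have hL := logCard_pos hn
  have h := exp_meanIndicator_le n (scale n / 2 ^ n) hn
  have h1 : (scale n / 2 ^ n) ^ 2 * 2 ^ n = logCard n := by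
    rw [div_pow, scale_sq]; field_simp
  have h2 : scale n / 2 ^ n = logCard n / scale n := by
    rw [div_eq_div_iff (by positivity) hs.ne', ← sq, scale_sq]; ring
  have h3 : (2 : ℝ) * 2 ^ n * Real.exp (logCard n) = Real.exp (Real.log 2 + 2 * logCard n) := by
    rw [Real.exp_add, Real.exp_log two_pos, two_mul (logCard n), Real.exp_add, exp_logCard]; ring
  rw [h1, h2, h3, Real.exp_le_exp] at h
  have h4 : meanIndicator n / scale n = (logCard n / scale n * meanIndicator n) / logCard n := by
    field_simp
  rw [h4, div_le_iff₀ hL]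
  refine h.trans_eq ?_
  field_simp
  ring

theorem tendsto_meanIndicator_div_scale :
    Tendsto (fun n => meanIndicator n / scale n) atTop (𝓝 2) := by
  refine tendsto_order.2 ⟨fun c hc => ?_, fun c hc => ?_⟩
  · filter_upwards [eventually_le_meanIndicator (a := max (1 / 2) (1 - (2 - c) / 4))
      (ε := (2 - c) / 4) (le_max_of_le_left (by norm_num))
      (max_lt (by norm_num) (by linarith)) (by linarith), eventually_ge_atTop 1] with n h hn
    rw [← le_div_iff₀ (scale_pos (by omega))] at h
    refine lt_of_lt_of_le ?_ h
    linarith [le_max_right (1 / 2) (1 - (2 - c) / 4)]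
  · have h : Tendsto (fun n => 2 + Real.log 2 * (logCard n)⁻¹) atTop (𝓝 2) := by
      simpa using (tendsto_logCard.inv_tendsto_atTop.const_mul (Real.log 2)).const_add 2
    filter_upwards [h.eventually_lt_const hc, eventually_ge_atTop 1] with n hn hn1
    exact (meanIndicator_div_scale_le (by omega)).trans_lt hn

/-! ### Expectation and probability under the uniform measure -/

theorem integral_unifBool {n : ℕ} (X : BoolFun n → ℝ) :
    ∫ f, X f ∂(unifBool n) = (∑ f, X f) / 2 ^ 2 ^ n := by
  have : IsProbabilityMeasure (unifBool n) := by unfold unifBool; infer_instance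
  rw [integral_fintype (Integrable.of_finite), Finset.sum_div]
  refine Finset.sum_congr rfl fun f _ => ?_
  rw [unifBool, measureReal_def, uniformOn_univ, Measure.count_singleton, card_boolFun]
  simp [div_eq_inv_mul]

theorem unifBool_apply {n : ℕ} (p : BoolFun n → Prop) [DecidablePred p] :
    unifBool n {f | p f} =
      ENNReal.ofReal (((Finset.univ.filter p).card : ℝ) / 2 ^ 2 ^ n) := by
  have : {f | p f} = ((Finset.univ.filter p : Finset (BoolFun n)) : Set (BoolFun n)) := by
    ext f; simp
  rw [unifBool, uniformOn_univ, this, Measure.count_apply_finset, card_boolFun,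
    ENNReal.ofReal_div_of_pos (by positivity), ENNReal.ofReal_natCast,
    ← Nat.cast_ofNat (R := ℝ), ← Nat.cast_pow, ENNReal.ofReal_natCast]

theorem tendsto_unifBool_deviation {ε : ℝ} (hε : 0 < ε) :
    Tendsto (fun n : ℕ => unifBool n {f : BoolFun n |
      |(absIndicator f : ℝ) / (2 * scale n) - 1| > ε}) atTop (𝓝 0) := by
  have hlim : Tendsto (fun n => ENNReal.ofReal (2 * Real.exp (-(ε ^ 2 / 8 * logCard n))))
      atTop (𝓝 0) := by
    have h : Tendsto (fun n => 2 * Real.exp (-(ε ^ 2 / 8 * logCard n))) atTop (𝓝 (2 * 0)) :=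
      (Real.tendsto_exp_neg_atTop_nhds_zero.comp
        (tendsto_logCard.const_mul_atTop (by positivity : 0 < ε ^ 2 / 8))).const_mul 2
    simpa using ENNReal.tendsto_ofReal h
  refine tendsto_of_tendsto_of_tendsto_of_le_of_le' tendsto_const_nhds hlim
    (Eventually.of_forall fun _ => zero_le) ?_
  -- The deviation is `2 * ε * scale n` in absolute terms: half is allotted to the mean's distance
  -- from `2 * scale n`, half to the fluctuation around the mean.
  filter_upwards [tendsto_meanIndicator_div_scale.eventually_lt_const
      (show (2 : ℝ) < 2 + ε by linarith), tendsto_meanIndicator_div_scale.eventually_const_lt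
      (show 2 - ε < (2 : ℝ) by linarith), eventually_ge_atTop 1] with n h1 h2 hn
  have hs := scale_pos (n := n) (by omega)
  rw [div_lt_iff₀ hs] at h1
  rw [lt_div_iff₀ hs] at h2
  classical
  rw [unifBool_apply]
  refine ENNReal.ofReal_le_ofReal ?_
  rw [div_le_iff₀ (by positivity)]
  have h3 := card_add_le_absIndicator n (s := ε * scale n) (by positivity)
  have h4 := card_absIndicator_le_sub n (s := ε * scale n) (by positivity)
  have h5 : (ε * scale n) ^ 2 / (8 * 2 ^ n) = ε ^ 2 / 8 * logCard n := by
    rw [mul_pow, scale_sq]; field_simp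
  rw [h5] at h3 h4
  have hsub : (Finset.univ.filter fun f : BoolFun n =>
      |(absIndicator f : ℝ) / (2 * scale n) - 1| > ε) ⊆
      (Finset.univ.filter fun f : BoolFun n =>
        meanIndicator n + ε * scale n ≤ (absIndicator f : ℝ)) ∪
      Finset.univ.filter fun f : BoolFun n =>
        (absIndicator f : ℝ) ≤ meanIndicator n - ε * scale n := by
    intro f hf
    simp only [Finset.mem_filter, Finset.mem_univ, true_and, Finset.mem_union, gt_iff_lt,
      lt_abs] at hf ⊢
    rcases hf with hf | hf
    · left
      have : (1 + ε) * (2 * scale n) < absIndicator f := by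
        rw [← lt_div_iff₀ (by positivity)]; linarith
      linarith
    · right
      have : (absIndicator f : ℝ) < (1 - ε) * (2 * scale n) := by
        rw [← div_lt_iff₀ (by positivity)]; linarith
      linarith
  have h6 : ((Finset.univ.filter fun f : BoolFun n =>
      |(absIndicator f : ℝ) / (2 * scale n) - 1| > ε).card : ℝ) ≤ _ :=
    Nat.cast_le.2 ((Finset.card_le_card hsub).trans (Finset.card_union_le _ _))
  push_cast at h6
  linarith

theorem theorem1 :
    Tendsto
      (fun n : ℕ =>
        (∫ f, (absIndicator f : ℝ) ∂(unifBool n)) /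
          Real.sqrt ((2 : ℝ) ^ n * Real.log ((2 : ℝ) ^ n)))
      atTop (𝓝 2) ∧
    ∀ ε : ℝ, 0 < ε →
      Tendsto
        (fun n : ℕ =>
          unifBool n
            {f : BoolFun n |
              |(absIndicator f : ℝ) /
                  (2 * Real.sqrt ((2 : ℝ) ^ n * Real.log ((2 : ℝ) ^ n))) - 1| > ε})
        atTop (𝓝 0) := by
  refine ⟨?_, fun ε hε => tendsto_unifBool_deviation hε⟩
  simp only [integral_unifBool]
  exact tendsto_meanIndicator_div_scale
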